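/- Let $\mathbb D$ be the open unit disc in $\mathbb C$, $dA$ area measure, and $\delta_b(z)=1-|z|$. Let $1<q<\infty$ and let $w:\mathbb D\to[0,\infty)$ be a Bekoll\'e--Bonami weight for the exponent $q$: $w$ is measurable and there is a finite constant $C$ such that, for every Euclidean disc $B$ whose closure meets $\partial\mathbb D$, \[ \left(\frac1{|B|}\int_{B\cap\mathbb D} w\,dA\right)\left(\frac1{|B|}\int_{B\cap\mathbb D} w^{-1/(q-1)}\,dA\right)^{q-1}\le C , \] where $|B|$ is the area of $B$ (with $0^{-1/(q-1)}=\infty$ and $0\cdot\infty=0$). Let $0<p<\infty$ and write $\|g\|_{L^p(w\,dA)}=\left(\int_{\mathbb D}|g|^p\,w\,dA\right)^{1/p}\in[0,\infty]$. Then the operator taking $f'\delta_b$ to $f-f(0)$, for $f$ analytic in $\mathbb D$, is bounded on $L^p(w\,dA)$: there is a finite constant $K$ such that \[ \|f-f(0)\|_{L^p(w\,dA)}\le K\,\|f'\delta_b\|_{L^p(w\,dA)} \] for every function $f$ analytic in $\mathbb D$. -/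

import Mathlib

open MeasureTheory Metric
open scoped NNReal ENNReal

/-- Distance to the boundary of the unit disc. -/
noncomputable def bdryDist (z : ℂ) : ℝ := 1 - ‖z‖

/-- The average `(1/|B|) ∫_B g dA` of a nonnegative function `g` on the unit disc over the
Euclidean disc `B = ball c r`; `g` is regarded as zero outside the unit disc, and `|B|` is the
area of `B`. -/
noncomputable def discAverage (g : ℂ → ℝ≥0∞) (c : ℂ) (r : ℝ) : ℝ≥0∞ :=
  (∫⁻ z in ball c r ∩ ball 0 1, g z) / volume (ball c r)

/-- `w` is a Bekollé–Bonami weight on the unit disc for the exponent `q`. Only the values of `w`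
on the unit disc matter. The negative power is taken in `[0, ∞]`, so it is `∞` where `w = 0`. -/
structure IsBekolleBonami (q : ℝ) (w : ℂ → ℝ≥0) : Prop where
  aemeasurable : AEMeasurable w (volume.restrict (ball 0 1))
  bound : ∃ C : ℝ≥0, ∀ (c : ℂ) (r : ℝ), 0 < r →
    (closure (ball c r) ∩ frontier (ball (0 : ℂ) 1)).Nonempty →
    discAverage (fun z => (w z : ℝ≥0∞)) c r *
      discAverage (fun z => (w z : ℝ≥0∞) ^ (-(1 / (q - 1)))) c r ^ (q - 1) ≤ C

/-- The measure `w dA` on the unit disc. -/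
noncomputable def weightedArea (w : ℂ → ℝ≥0) : Measure ℂ :=
  (volume.restrict (ball 0 1)).withDensity (fun z => (w z : ℝ≥0∞))

/-! Write `μ = w dA` and `δ = bdryDist`. If `G` is a product of positive powers of moduli of
analytic functions, then so is `G ^ (1/q)`; it is log-subharmonic, hence has the sub-mean value
property. Hölder's inequality against `w` and the Bekollé–Bonami condition on the disc `B(u,
7δ(u))`, whose closure meets the circle, turn this into `G(u) μ(B(u, 7δ(u))) ≤ C ∫ G dμ` over `B(u,
δ(u)/2)`.

For `u = tz` on the radius to `z`, each `ζ` in the small disc has `|z - ζ| < 4δ(ζ)` and `B(ζ, 4δ(ζ))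
⊆ B(u, 7δ(u))`. So `G(tz)` is dominated by `spreadAverage` at `z` of `G` truncated to `1 - t|z| ≤
2δ(ζ)` (`exists_le_spreadAverage`). By Tonelli `spreadAverage` is a contraction on `L¹(μ)`, so no
maximal function is needed.

For `p > 1`, take `G = |h|^(p-1) |h'|` and integrate radially. Integrating the truncation in `t`
produces the factor `2δ(ζ)`, so `∫ |h|^p dμ ≤ C ∫ |h|^(p-1) |h'| δ dμ`. Hölder finishes if the left
side is finite; dilations and Fatou remove that proviso.

For `p ≤ 1`, cut the radius at `1 - 2^(-n)`, use subadditivity of `x ↦ x^p` with `G = |f'|^p`, and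
sum a truncated geometric series to recover `δ^p`. -/

/-! ### Sub-mean value property for products of powers of moduli -/

/-- The logarithm of the modulus of an analytic function has the sub-mean value property. -/
theorem AnalyticOnNhd.log_norm_le_circleAverage {f : ℂ → ℂ} {c : ℂ} {R : ℝ} (hR : R ≠ 0)
    (hf : AnalyticOnNhd ℂ f (closedBall c |R|)) (hc : f c ≠ 0) :
    Real.log ‖f c‖ ≤ Real.circleAverage (fun z => Real.log ‖f z‖) c R := by
  rw [hf.circleAverage_log_norm hR hc]
  -- In Jensen's formula each zero `u` contributes its multiplicity times `log (R / |c - u|) ≥ 0`.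
  refine le_add_of_nonneg_left (finsum_nonneg fun u => ?_)
  by_cases hu : u ∈ closedBall c |R|
  · refine mul_nonneg (by exact_mod_cast MeromorphicOn.AnalyticOnNhd.divisor_nonneg hf u) ?_
    rw [← Real.log_abs, abs_mul, abs_inv, abs_of_nonneg (norm_nonneg (c - u))]
    rcases eq_or_ne (c - u) 0 with h | h
    · simp [h]
    · refine Real.log_nonneg ?_
      rw [← div_eq_mul_inv, one_le_div (norm_pos_iff.2 h)]
      simpa [dist_eq_norm, norm_sub_rev] using hu
  · simp [hu]

/-- The logarithm of the product is a positive combination of functions with the sub-mean value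
property; Jensen's inequality for `exp` transfers the property to the product. -/
theorem AnalyticOnNhd.rpow_mul_rpow_le_circleAverage {f g : ℂ → ℂ} {c : ℂ} {R a b : ℝ}
    (hR : R ≠ 0) (hf : AnalyticOnNhd ℂ f (closedBall c |R|))
    (hg : AnalyticOnNhd ℂ g (closedBall c |R|)) (ha : 0 < a) (hb : 0 < b) :
    ‖f c‖ ^ a * ‖g c‖ ^ b ≤ Real.circleAverage (fun z => ‖f z‖ ^ a * ‖g z‖ ^ b) c R := by
  by_cases hfc : f c = 0
  · rw [hfc, norm_zero, Real.zero_rpow ha.ne', zero_mul]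
    exact Real.circleAverage_nonneg_of_nonneg fun _ _ => by positivity
  by_cases hgc : g c = 0
  · rw [hgc, norm_zero, Real.zero_rpow hb.ne', mul_zero]
    exact Real.circleAverage_nonneg_of_nonneg fun _ _ => by positivity
  have hsph : sphere c |R| ⊆ closedBall c |R| := sphere_subset_closedBall
  have hcon : IsConnected (closedBall c |R|) :=
    (convex_closedBall c |R|).isConnected (nonempty_closedBall.2 (abs_nonneg R))
  have hcc : c ∈ closedBall c |R| := mem_closedBall_self (abs_nonneg R)
  set L : ℂ → ℝ := fun z => a * Real.log ‖f z‖ + b * Real.log ‖g z‖ with hL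
  have hfi : CircleIntegrable (fun z => Real.log ‖f z‖) c R :=
    (hf.mono hsph).meromorphicOn.circleIntegrable_log_norm
  have hgi : CircleIntegrable (fun z => Real.log ‖g z‖) c R :=
    (hg.mono hsph).meromorphicOn.circleIntegrable_log_norm
  have hLi : CircleIntegrable L c R := (hfi.const_mul a).add (hgi.const_mul b)
  have hlog : L c ≤ Real.circleAverage L c R := by
    have h : Real.circleAverage L c R =
        a * Real.circleAverage (fun z => Real.log ‖f z‖) c R +
          b * Real.circleAverage (fun z => Real.log ‖g z‖) c R := by
      rw [hL, Real.circleAverage_fun_add (c := c) (R := R)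
        (f₁ := fun z => a * Real.log ‖f z‖) (f₂ := fun z => b * Real.log ‖g z‖)
        (hfi.const_mul a) (hgi.const_mul b)]
      simp only [← smul_eq_mul, Real.circleAverage_fun_smul]
    rw [h]
    have h1 := hf.log_norm_le_circleAverage hR hfc
    have h2 := hg.log_norm_le_circleAverage hR hgc
    simp only [hL]
    gcongr
  have hexp : ∀ z, f z ≠ 0 → g z ≠ 0 → Real.exp (L z) = ‖f z‖ ^ a * ‖g z‖ ^ b := by
    intro z h1 h2
    rw [hL, Real.exp_add, Real.rpow_def_of_pos (norm_pos_iff.2 h1),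
      Real.rpow_def_of_pos (norm_pos_iff.2 h2), mul_comm a, mul_comm b]
  -- At a zero of `f` or `g` the convention `log 0 = 0` spoils the identity, but the zeros form a
  -- discrete set, invisible to circle averages.
  have hae : (fun z => ‖f z‖ ^ a * ‖g z‖ ^ b) =ᶠ[Filter.codiscreteWithin (sphere c |R|)]
      fun z => Real.exp (L z) := by
    have h1 := hf.preimage_zero_mem_codiscreteWithin hfc hcc hcon
    have h2 := hg.preimage_zero_mem_codiscreteWithin hgc hcc hcon
    filter_upwards [Filter.codiscreteWithin_mono hsph h1,
      Filter.codiscreteWithin_mono hsph h2] with z h1 h2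
    exact (hexp z (by simpa using h1) (by simpa using h2)).symm
  have hint : CircleIntegrable (fun z => ‖f z‖ ^ a * ‖g z‖ ^ b) c R := by
    refine ContinuousOn.circleIntegrable' ?_
    exact ((hf.mono hsph).continuousOn.norm.rpow_const fun _ _ => Or.inr ha.le).mul
      ((hg.mono hsph).continuousOn.norm.rpow_const fun _ _ => Or.inr hb.le)
  have hexpi : CircleIntegrable (fun z => Real.exp (L z)) c R := hint.congr_codiscreteWithin hae
  rw [Real.circleAverage_congr_codiscreteWithin hae hR, ← hexp c hfc hgc]
  refine (Real.exp_le_exp.2 hlog).trans ?_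
  rw [Real.circleAverage_eq_intervalAverage, Real.circleAverage_eq_intervalAverage]
  have hpi : (0 : ℝ) ≤ 2 * Real.pi := by positivity
  have : NeZero (volume.restrict (Set.uIoc 0 (2 * Real.pi))) := by
    refine ⟨fun h => ?_⟩
    have := Measure.restrict_eq_zero.1 h
    simp [Set.uIoc_of_le hpi] at this
    exact absurd Real.pi_pos this.not_gt
  have : IsFiniteMeasure (volume.restrict (Set.uIoc 0 (2 * Real.pi))) := by
    rw [Set.uIoc_of_le hpi]; infer_instance
  refine convexOn_exp.map_average_le Real.continuous_exp.continuousOn isClosed_univ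
    (by simp) ?_ ?_
  · exact hLi.def'
  · exact hexpi.def'

theorem ContinuousOn.measurable_indicator {X Y : Type*} [TopologicalSpace X] [MeasurableSpace X]
    [OpensMeasurableSpace X] [TopologicalSpace Y] [MeasurableSpace Y] [BorelSpace Y] [Zero Y]
    {f : X → Y} {s : Set X} (hf : ContinuousOn f s) (hs : MeasurableSet s) :
    Measurable (s.indicator f) := by
  classical
  rw [← Set.piecewise_eq_indicator]
  exact hf.measurable_piecewise continuousOn_const hs

theorem enorm_rpow_mul_rpow (x y : ℂ) {a b : ℝ} (ha : 0 ≤ a) (hb : 0 ≤ b) :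
    ‖‖x‖ ^ a * ‖y‖ ^ b‖ₑ = ‖x‖ₑ ^ a * ‖y‖ₑ ^ b := by
  rw [enorm_mul, Real.enorm_rpow_of_nonneg (norm_nonneg x) ha,
    Real.enorm_rpow_of_nonneg (norm_nonneg y) hb, enorm_norm, enorm_norm]

theorem lintegral_comp_add_rotation (H : ℂ → ℝ≥0∞) (c : ℂ) (θ : ℝ) :
    ∫⁻ z, H (c + circleMap 0 1 θ * z) = ∫⁻ z, H z := by
  have h := (rotation (Circle.exp θ)).measurePreserving.lintegral_comp_emb
    (rotation (Circle.exp θ)).toHomeomorph.measurableEmbedding (fun z => H (c + z))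
  rw [lintegral_add_left_eq_self] at h
  rw [← h]
  simp [circleMap]

/-- Products of positive powers of moduli of analytic functions have the sub-mean value property
over discs. -/
theorem AnalyticOnNhd.rpow_mul_rpow_le_lintegral_ball {f g : ℂ → ℂ} {c : ℂ} {r a b : ℝ}
    (hf : AnalyticOnNhd ℂ f (ball c r)) (hg : AnalyticOnNhd ℂ g (ball c r))
    (ha : 0 < a) (hb : 0 < b) :
    ‖f c‖ₑ ^ a * ‖g c‖ₑ ^ b * volume (ball c r) ≤ ∫⁻ z in ball c r, ‖f z‖ₑ ^ a * ‖g z‖ₑ ^ b := by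
  set H : ℂ → ℝ≥0∞ := (ball c r).indicator fun z => ‖‖f z‖ ^ a * ‖g z‖ ^ b‖ₑ with hH
  have hHm : Measurable H := by
    refine ContinuousOn.measurable_indicator ?_ measurableSet_ball
    exact ((hf.continuousOn.norm.rpow_const fun _ _ => Or.inr ha.le).mul
      (hg.continuousOn.norm.rpow_const fun _ _ => Or.inr hb.le)).enorm
  -- Polar coordinates are avoided: the circle through `c + z` is parametrised by `η ↦ c + η * z` on
  -- the unit circle. Integrating over `z` and swapping, each rotation preserves area.
  have hcirc : ∀ z ∈ ball (0 : ℂ) r, ‖f c‖ₑ ^ a * ‖g c‖ₑ ^ b * ENNReal.ofReal (2 * Real.pi) ≤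
      ∫⁻ θ in Set.Ioc 0 (2 * Real.pi), H (c + circleMap 0 1 θ * z) := by
    intro z hz
    rw [mem_ball_zero_iff] at hz
    have hmem : ∀ η ∈ closedBall (0 : ℂ) |1|, c + η * z ∈ ball c r := by
      intro η hη
      simp only [abs_one, mem_closedBall, dist_zero_right] at hη
      rw [mem_ball_iff_norm, add_sub_cancel_left, norm_mul]
      nlinarith [norm_nonneg z]
    have hlin : AnalyticOnNhd ℂ (fun η => c + η * z) (closedBall (0 : ℂ) |1|) :=
      fun _ _ => by fun_prop
    have h := AnalyticOnNhd.rpow_mul_rpow_le_circleAverage (R := 1) (c := 0) one_ne_zero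
      (hf.comp hlin hmem) (hg.comp hlin hmem) ha hb
    simp only [Function.comp_apply, zero_mul, add_zero] at h
    have hpi : (0 : ℝ) < 2 * Real.pi := by positivity
    rw [Real.circleAverage_def, smul_eq_mul, inv_mul_eq_div, le_div_iff₀ hpi,
      intervalIntegral.integral_of_le hpi.le] at h
    rw [← enorm_rpow_mul_rpow _ _ ha.le hb.le, ← Real.enorm_of_nonneg hpi.le, ← enorm_mul]
    have h0 : 0 ≤ ‖f c‖ ^ a * ‖g c‖ ^ b * (2 * Real.pi) := by positivity
    refine (ENNReal.ofReal_le_ofReal h |>.trans' (Real.enorm_of_nonneg h0).le).trans ?_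
    rw [← Real.enorm_of_nonneg (h0.trans h)]
    refine (enorm_integral_le_lintegral_enorm _).trans (lintegral_mono fun θ => ?_)
    rw [hH, Set.indicator_of_mem (hmem _ (by simp))]
  have hpi : ENNReal.ofReal (2 * Real.pi) ≠ 0 := by simp [Real.pi_pos]
  rw [← ENNReal.mul_le_mul_iff_left hpi ENNReal.ofReal_ne_top]
  calc ‖f c‖ₑ ^ a * ‖g c‖ₑ ^ b * volume (ball c r) * ENNReal.ofReal (2 * Real.pi)
      = ∫⁻ _ in ball (0 : ℂ) r, ‖f c‖ₑ ^ a * ‖g c‖ₑ ^ b * ENNReal.ofReal (2 * Real.pi) := by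
        rw [setLIntegral_const, Complex.volume_ball, Complex.volume_ball]; ring
    _ ≤ ∫⁻ z in ball (0 : ℂ) r,
          ∫⁻ θ in Set.Ioc 0 (2 * Real.pi), H (c + circleMap 0 1 θ * z) :=
        setLIntegral_mono' measurableSet_ball hcirc
    _ ≤ ∫⁻ z, ∫⁻ θ in Set.Ioc 0 (2 * Real.pi), H (c + circleMap 0 1 θ * z) :=
        setLIntegral_le_lintegral _ _
    _ = ∫⁻ θ in Set.Ioc 0 (2 * Real.pi), ∫⁻ z, H (c + circleMap 0 1 θ * z) := by
        refine lintegral_lintegral_swap (Measurable.aemeasurable ?_)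
        refine hHm.comp (Continuous.measurable ?_)
        have := continuous_circleMap 0 1
        fun_prop
    _ = (∫⁻ z in ball c r, ‖f z‖ₑ ^ a * ‖g z‖ₑ ^ b) * ENNReal.ofReal (2 * Real.pi) := by
        simp only [lintegral_comp_add_rotation]
        rw [setLIntegral_const, Real.volume_Ioc, sub_zero, hH,
          lintegral_indicator measurableSet_ball]
        simp only [enorm_rpow_mul_rpow _ _ ha.le hb.le]

/-! ### Geometry of the distance to the boundary -/

theorem continuous_bdryDist : Continuous bdryDist := continuous_const.sub continuous_norm

theorem bdryDist_pos {z : ℂ} (hz : z ∈ ball (0 : ℂ) 1) : 0 < bdryDist z := by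
  rw [mem_ball_zero_iff] at hz
  exact sub_pos.2 hz

theorem bdryDist_le_add_dist (z ζ : ℂ) : bdryDist z ≤ bdryDist ζ + dist z ζ := by
  have := norm_le_norm_add_norm_sub' ζ z
  rw [← dist_eq_norm, dist_comm] at this
  simp only [bdryDist]
  linarith

theorem ball_half_bdryDist_subset (u : ℂ) : ball u (bdryDist u / 2) ⊆ ball (0 : ℂ) 1 := by
  intro ζ hζ
  rw [mem_ball, dist_comm] at hζ
  have h := bdryDist_le_add_dist u ζ
  have : 0 < bdryDist u := by linarith [dist_nonneg (x := u) (y := ζ)]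
  rw [mem_ball_zero_iff]
  simp only [bdryDist] at *
  linarith

theorem closure_ball_inter_frontier_nonempty {u : ℂ} (hu : u ∈ ball (0 : ℂ) 1) {r : ℝ}
    (hr : bdryDist u ≤ r) :
    (closure (ball u r) ∩ frontier (ball (0 : ℂ) 1)).Nonempty := by
  have hpos := bdryDist_pos hu
  rw [closure_ball _ (hpos.trans_le hr).ne', frontier_ball _ one_ne_zero]
  obtain ⟨v, hv, huv⟩ : ∃ v : ℂ, ‖v‖ = 1 ∧ u = ‖u‖ * v := by
    rcases eq_or_ne u 0 with rfl | h
    · exact ⟨1, by simp, by simp⟩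
    · have h' : (‖u‖ : ℂ) ≠ 0 := by simpa using h
      exact ⟨u / ‖u‖, by simp [h], by field_simp⟩
  refine ⟨v, ?_, by simpa using hv⟩
  rw [mem_closedBall_iff_norm]
  calc ‖v - u‖ = ‖((1 - ‖u‖ : ℝ) : ℂ) * v‖ := by
        conv_lhs => rw [huv]
        push_cast; ring_nf
    _ = bdryDist u := by
        rw [norm_mul, hv, mul_one, Complex.norm_real]
        exact Real.norm_of_nonneg hpos.le
    _ ≤ r := hr

/-! ### The weighted measure and the Bekollé–Bonami condition -/

theorem weightedArea_apply (w : ℂ → ℝ≥0) {s : Set ℂ} (hs : MeasurableSet s) :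
    weightedArea w s = ∫⁻ z in s ∩ ball 0 1, w z := by
  rw [weightedArea, withDensity_apply _ hs, Measure.restrict_restrict hs]

theorem ae_weightedArea_mem_ball (w : ℂ → ℝ≥0) : ∀ᵐ z ∂weightedArea w, z ∈ ball (0 : ℂ) 1 :=
  (withDensity_absolutelyContinuous _ _).ae_le (ae_restrict_mem measurableSet_ball)

namespace IsBekolleBonami

variable {q : ℝ} {w : ℂ → ℝ≥0}

theorem exists_mul_rpow_le (hq : 1 < q) (hw : IsBekolleBonami q w) :
    ∃ C : ℝ≥0, ∀ (c : ℂ) (r : ℝ), 0 < r →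
      (closure (ball c r) ∩ frontier (ball (0 : ℂ) 1)).Nonempty →
      weightedArea w (ball c r) *
        (∫⁻ z in ball c r ∩ ball 0 1, (w z : ℝ≥0∞) ^ (-(1 / (q - 1)))) ^ (q - 1) ≤
        C * volume (ball c r) ^ q := by
  obtain ⟨C, hC⟩ := hw.bound
  refine ⟨C, fun c r hr hne => ?_⟩
  have h := hC c r hr hne
  have hV0 : volume (ball c r) ≠ 0 := (measure_ball_pos volume c hr).ne'
  have hVt : volume (ball c r) ≠ ∞ := measure_ball_lt_top.ne
  have hq1 : 0 ≤ q - 1 := by linarith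
  simp only [discAverage] at h
  rw [ENNReal.div_rpow_of_nonneg _ _ hq1, ← weightedArea_apply w measurableSet_ball,
    div_eq_mul_inv, div_eq_mul_inv, mul_mul_mul_comm,
    ← ENNReal.mul_inv (Or.inl hV0) (Or.inl hVt), ← div_eq_mul_inv] at h
  have hVq : volume (ball c r) * volume (ball c r) ^ (q - 1) = volume (ball c r) ^ q := by
    conv_lhs => rw [← ENNReal.rpow_one (volume (ball c r)), ← ENNReal.rpow_mul, one_mul]
    rw [← ENNReal.rpow_add _ _ hV0 hVt, add_sub_cancel]
  rw [hVq] at h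
  refine (ENNReal.div_le_iff_le_mul (Or.inl ?_) (Or.inl ?_)).1 h
  · exact (ENNReal.rpow_pos (pos_iff_ne_zero.2 hV0) hVt).ne'
  · exact ENNReal.rpow_ne_top_of_nonneg (by linarith) hVt

theorem weightedArea_univ_eq (w : ℂ → ℝ≥0) :
    weightedArea w Set.univ = weightedArea w (ball 0 2) := by
  rw [weightedArea_apply w MeasurableSet.univ, weightedArea_apply w measurableSet_ball,
    Set.univ_inter, Set.inter_eq_right.2 (ball_subset_ball one_le_two)]

theorem weightedArea_mul_rpow_lt_top (hq : 1 < q) (hw : IsBekolleBonami q w) :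
    weightedArea w Set.univ *
      (∫⁻ z in ball 0 1, (w z : ℝ≥0∞) ^ (-(1 / (q - 1)))) ^ (q - 1) < ∞ := by
  obtain ⟨C, hC⟩ := hw.exists_mul_rpow_le hq
  have h := hC 0 2 two_pos
    (closure_ball_inter_frontier_nonempty (by simp) (by simp [bdryDist]))
  rw [Set.inter_eq_right.2 (ball_subset_ball one_le_two), ← weightedArea_univ_eq] at h
  exact h.trans_lt (ENNReal.mul_lt_top ENNReal.coe_lt_top
    (ENNReal.rpow_lt_top_of_nonneg (by linarith) measure_ball_lt_top.ne))

theorem aemeasurable_dual (hw : IsBekolleBonami q w) :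
    AEMeasurable (fun z => (w z : ℝ≥0∞) ^ (-(1 / (q - 1)))) (volume.restrict (ball 0 1)) :=
  hw.aemeasurable.coe_nnreal_ennreal.pow_const _

/-- The disc `ball 0 2` is admissible and contains the unit disc. As `w` is finite, its negative
power is positive everywhere, so the dual integral is not zero and infinite mass would make the
product infinite. -/
theorem isFiniteMeasure (hq : 1 < q) (hw : IsBekolleBonami q w) :
    IsFiniteMeasure (weightedArea w) := by
  refine ⟨lt_top_iff_ne_top.2 fun h => ?_⟩
  have hlt := hw.weightedArea_mul_rpow_lt_top hq
  rw [h] at hlt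
  have hq1 : 0 < q - 1 := by linarith
  refine hlt.ne (ENNReal.top_mul ?_)
  rw [Ne, ENNReal.rpow_eq_zero_iff_of_pos hq1, lintegral_eq_zero_iff' hw.aemeasurable_dual]
  intro h0
  have hfalse : ∀ᵐ z ∂(volume.restrict (ball (0 : ℂ) 1)), False := by
    filter_upwards [h0] with z hz
    simp [ENNReal.rpow_eq_zero_iff, hq] at hz
    linarith
  have := Measure.restrict_eq_zero.1 (ae_eq_bot.1 (Filter.eventually_false_iff_eq_bot.1 hfalse))
  exact (measure_ball_pos volume (0 : ℂ) one_pos).ne' this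

/-- With positive mass the dual integral must be finite, while its integrand is `∞` wherever `w =
0`. -/
theorem ae_ne_zero (hq : 1 < q) (hw : IsBekolleBonami q w) (h : weightedArea w ≠ 0) :
    ∀ᵐ z ∂(volume.restrict (ball 0 1)), (w z : ℝ≥0∞) ≠ 0 := by
  have hlt := hw.weightedArea_mul_rpow_lt_top hq
  have hq1 : 0 < q - 1 := by linarith
  have hne : ∫⁻ z in ball 0 1, (w z : ℝ≥0∞) ^ (-(1 / (q - 1))) ≠ ∞ := by
    intro h0
    rw [h0, ENNReal.top_rpow_of_pos hq1,
      ENNReal.mul_top (Measure.measure_univ_ne_zero.2 h)] at hlt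
    exact hlt.ne rfl
  filter_upwards [ae_lt_top' hw.aemeasurable_dual hne] with z hz h0
  rw [h0, ENNReal.zero_rpow_of_neg (by rw [neg_lt_zero]; positivity)] at hz
  exact hz.ne rfl

/-- Weighted point evaluation estimate on a hyperbolic disc. -/
theorem exists_mul_weightedArea_le (hq : 1 < q) (hw : IsBekolleBonami q w)
    (h0 : weightedArea w ≠ 0) :
    ∃ C : ℝ≥0, ∀ G : ℂ → ℝ≥0∞, Measurable G → ∀ u ∈ ball (0 : ℂ) 1,
      G u ^ q⁻¹ * volume (ball u (bdryDist u / 2)) ≤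
        ∫⁻ z in ball u (bdryDist u / 2), G z ^ q⁻¹ →
      G u * weightedArea w (ball u (7 * bdryDist u)) ≤
        C * ∫⁻ z in ball u (bdryDist u / 2), G z ∂weightedArea w := by
  obtain ⟨C, hC⟩ := hw.exists_mul_rpow_le hq
  have hq0 : 0 < q := by linarith
  have hq1 : 0 < q - 1 := by linarith
  -- `196 = 14 ^ 2` is the ratio of the areas of the discs of radii `7δ(u)` and `δ(u)/2`.
  refine ⟨C * (196 : ℝ≥0) ^ q, fun G hG u hu hsub => ?_⟩
  set s := ball u (bdryDist u / 2)
  have hδ := bdryDist_pos hu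
  have hsD : s ⊆ ball 0 1 := ball_half_bdryDist_subset u
  have hV0 : volume s ≠ 0 := (measure_ball_pos volume u (by positivity)).ne'
  have hVt : volume s ≠ ∞ := measure_ball_lt_top.ne
  have hwm : AEMeasurable (fun z => (w z : ℝ≥0∞)) (volume.restrict s) :=
    (hw.aemeasurable.mono_measure (Measure.restrict_mono hsD le_rfl)).coe_nnreal_ennreal
  have hw0 : ∀ᵐ z ∂(volume.restrict s), (w z : ℝ≥0∞) ≠ 0 :=
    ae_mono (Measure.restrict_mono hsD le_rfl) (hw.ae_ne_zero hq h0)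
  have hGμ : ∫⁻ z in s, G z * w z = ∫⁻ z in s, G z ∂weightedArea w := by
    rw [weightedArea, restrict_withDensity measurableSet_ball,
      Measure.restrict_restrict measurableSet_ball, Set.inter_eq_left.2 hsD,
      lintegral_withDensity_eq_lintegral_mul₀ hwm hG.aemeasurable]
    simp [mul_comm]
  have hconj : q.HolderConjugate (q / (q - 1)) := Real.HolderConjugate.conjExponent hq
  -- Hölder for `G ^ (1/q) = (G w) ^ (1/q) * w ^ (-1/q)`, a factorisation valid where `w ≠ 0`.
  have hholder : ∫⁻ z in s, G z ^ q⁻¹ ≤ (∫⁻ z in s, G z * w z) ^ q⁻¹ *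
      (∫⁻ z in s, (w z : ℝ≥0∞) ^ (-(1 / (q - 1)))) ^ ((q - 1) / q) := by
    have h := ENNReal.lintegral_mul_le_Lp_mul_Lq (volume.restrict s) hconj
      (f := fun z => (G z * w z) ^ q⁻¹) (g := fun z => (w z : ℝ≥0∞) ^ (-q⁻¹))
      ((hG.aemeasurable.mul hwm).pow_const _) (hwm.pow_const _)
    simp only [← ENNReal.rpow_mul, inv_mul_cancel₀ hq0.ne', ENNReal.rpow_one, one_div_div,
      one_div q] at h
    have he : -q⁻¹ * (q / (q - 1)) = -(1 / (q - 1)) := by field_simp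
    rw [he] at h
    refine le_trans (lintegral_mono_ae ?_) h
    filter_upwards [hw0] with z hz
    have hz' : (w z : ℝ≥0∞) ≠ ∞ := ENNReal.coe_ne_top
    rw [Pi.mul_apply, ENNReal.mul_rpow_of_nonneg _ _ (by positivity), mul_assoc,
      ← ENNReal.rpow_add _ _ hz hz', add_neg_cancel, ENNReal.rpow_zero, mul_one]
  have hpow : G u * volume s ^ q ≤ (∫⁻ z in s, G z ∂weightedArea w) *
      (∫⁻ z in s, (w z : ℝ≥0∞) ^ (-(1 / (q - 1)))) ^ (q - 1) := by
    have h := ENNReal.rpow_le_rpow (hsub.trans hholder) hq0.le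
    rw [ENNReal.mul_rpow_of_nonneg _ _ hq0.le, ENNReal.mul_rpow_of_nonneg _ _ hq0.le,
      ← ENNReal.rpow_mul, ← ENNReal.rpow_mul, ← ENNReal.rpow_mul, inv_mul_cancel₀ hq0.ne',
      div_mul_cancel₀ _ hq0.ne', ENNReal.rpow_one, ENNReal.rpow_one, hGμ] at h
    exact h
  have hsB : s ⊆ ball u (7 * bdryDist u) ∩ ball 0 1 :=
    Set.subset_inter (ball_subset_ball (by linarith)) hsD
  have hB := hC u (7 * bdryDist u) (by positivity)
    (closure_ball_inter_frontier_nonempty hu (by linarith))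
  have hvol : volume (ball u (7 * bdryDist u)) = 196 * volume s := by
    rw [Complex.volume_ball, Complex.volume_ball, ← mul_assoc,
      show 7 * bdryDist u = 14 * (bdryDist u / 2) by ring, ENNReal.ofReal_mul (by norm_num),
      mul_pow]
    congr 2
    norm_num
  have hVq0 : volume s ^ q ≠ 0 := (ENNReal.rpow_pos (pos_iff_ne_zero.2 hV0) hVt).ne'
  have hVqt : volume s ^ q ≠ ∞ := ENNReal.rpow_ne_top_of_nonneg hq0.le hVt
  rw [← ENNReal.mul_le_mul_iff_left hVq0 hVqt]
  calc G u * weightedArea w (ball u (7 * bdryDist u)) * volume s ^ q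
      = weightedArea w (ball u (7 * bdryDist u)) * (G u * volume s ^ q) := by ring
    _ ≤ weightedArea w (ball u (7 * bdryDist u)) * ((∫⁻ z in s, G z ∂weightedArea w) *
          (∫⁻ z in ball u (7 * bdryDist u) ∩ ball 0 1,
            (w z : ℝ≥0∞) ^ (-(1 / (q - 1)))) ^ (q - 1)) := by
        refine mul_le_mul_right (hpow.trans (mul_le_mul_right ?_ _)) _
        exact ENNReal.rpow_le_rpow (lintegral_mono_set hsB) hq1.le
    _ = (∫⁻ z in s, G z ∂weightedArea w) * (weightedArea w (ball u (7 * bdryDist u)) *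
          (∫⁻ z in ball u (7 * bdryDist u) ∩ ball 0 1,
            (w z : ℝ≥0∞) ^ (-(1 / (q - 1)))) ^ (q - 1)) := by ring
    _ ≤ (∫⁻ z in s, G z ∂weightedArea w) * (C * volume (ball u (7 * bdryDist u)) ^ q) :=
        mul_le_mul_right hB _
    _ = _ := by
        rw [hvol, ENNReal.mul_rpow_of_nonneg _ _ hq0.le, ENNReal.coe_mul,
          ENNReal.coe_rpow_of_nonneg _ hq0.le]
        push_cast
        ring

end IsBekolleBonami

/-! ### The averaging operator -/

/-- The sum over `ζ` of the averages of the mass `H ζ dμ(ζ)` over the disc `ball ζ (4 (1 - |ζ|))`,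
evaluated at `z`. -/
noncomputable def spreadAverage (μ : Measure ℂ) (H : ℂ → ℝ≥0∞) (z : ℂ) : ℝ≥0∞ :=
  ∫⁻ ζ in {ζ | dist z ζ < 4 * bdryDist ζ}, H ζ / μ (ball ζ (4 * bdryDist ζ)) ∂μ

section spreadAverage

variable {μ : Measure ℂ} {H H' : ℂ → ℝ≥0∞}

theorem measurableSet_dist_lt_bdryDist :
    MeasurableSet {x : ℂ × ℂ | dist x.1 x.2 < 4 * bdryDist x.2} := by
  have := continuous_bdryDist
  exact (isOpen_lt (by fun_prop) (by fun_prop)).measurableSet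

theorem measurableSet_dist_lt_bdryDist_right (z : ℂ) :
    MeasurableSet {ζ : ℂ | dist z ζ < 4 * bdryDist ζ} :=
  measurable_prodMk_left measurableSet_dist_lt_bdryDist

theorem measurable_measure_ball_bdryDist [SFinite μ] :
    Measurable fun ζ => μ (ball ζ (4 * bdryDist ζ)) :=
  measurable_measure_prodMk_right (μ := μ) measurableSet_dist_lt_bdryDist

/-- Comparison inside the disc suffices: `0 ≤ dist z ζ < 4 * bdryDist ζ` forces `ζ` into it. -/
theorem spreadAverage_mono (h : ∀ ζ ∈ ball (0 : ℂ) 1, H ζ ≤ H' ζ) (z : ℂ) :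
    spreadAverage μ H z ≤ spreadAverage μ H' z := by
  refine setLIntegral_mono' (measurableSet_dist_lt_bdryDist_right z) fun ζ hζ => ?_
  refine ENNReal.div_le_div_right (h ζ ?_) _
  have hζ' : dist z ζ < 4 * bdryDist ζ := hζ
  rw [mem_ball_zero_iff]
  have := dist_nonneg (x := z) (y := ζ)
  simp only [bdryDist] at hζ'
  linarith

theorem spreadAverage_const_mul {c : ℝ≥0∞} (hc : c ≠ ∞) (H : ℂ → ℝ≥0∞) (z : ℂ) :
    spreadAverage μ (fun ζ => c * H ζ) z = c * spreadAverage μ H z := by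
  rw [spreadAverage, spreadAverage, ← lintegral_const_mul' _ _ hc]
  simp only [mul_div_assoc]

theorem spreadAverage_add [SFinite μ] (hH : Measurable H) (H' : ℂ → ℝ≥0∞) (z : ℂ) :
    spreadAverage μ (fun ζ => H ζ + H' ζ) z = spreadAverage μ H z + spreadAverage μ H' z := by
  simp only [spreadAverage, ENNReal.add_div]
  exact lintegral_add_left (hH.div measurable_measure_ball_bdryDist) _

theorem spreadAverage_eq_lintegral_indicator (H : ℂ → ℝ≥0∞) (z : ℂ) :
    spreadAverage μ H z = ∫⁻ ζ, {x : ℂ × ℂ | dist x.1 x.2 < 4 * bdryDist x.2}.indicator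
      (fun x => H x.2 / μ (ball x.2 (4 * bdryDist x.2))) (z, ζ) ∂μ := by
  rw [spreadAverage, ← lintegral_indicator (measurableSet_dist_lt_bdryDist_right z)]
  rfl

theorem measurable_spreadAverage_kernel [SFinite μ] (hH : Measurable H) :
    Measurable ({x : ℂ × ℂ | dist x.1 x.2 < 4 * bdryDist x.2}.indicator
      (fun x => H x.2 / μ (ball x.2 (4 * bdryDist x.2)))) :=
  ((hH.div measurable_measure_ball_bdryDist).comp measurable_snd).indicator
    measurableSet_dist_lt_bdryDist

/-- By Tonelli, the mass at `ζ` is spread over a ball with density the reciprocal of that ball's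
measure, so its total does not grow. -/
theorem lintegral_spreadAverage_le [SFinite μ] (hH : Measurable H) :
    ∫⁻ z, spreadAverage μ H z ∂μ ≤ ∫⁻ ζ, H ζ ∂μ := by
  simp only [spreadAverage_eq_lintegral_indicator]
  rw [lintegral_lintegral_swap (f := fun z ζ => {x : ℂ × ℂ | dist x.1 x.2 < 4 * bdryDist x.2}.indicator
      (fun x => H x.2 / μ (ball x.2 (4 * bdryDist x.2))) (z, ζ))
    (measurable_spreadAverage_kernel hH).aemeasurable]
  refine lintegral_mono fun ζ => ?_
  have h : ∀ z, {x : ℂ × ℂ | dist x.1 x.2 < 4 * bdryDist x.2}.indicator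
      (fun x => H x.2 / μ (ball x.2 (4 * bdryDist x.2))) (z, ζ) =
      (ball ζ (4 * bdryDist ζ)).indicator (fun _ => H ζ / μ (ball ζ (4 * bdryDist ζ))) z :=
    fun z => rfl
  simp only [h]
  rw [lintegral_indicator_const measurableSet_ball]
  rw [div_eq_mul_inv, mul_assoc]
  exact mul_le_of_le_one_right' (ENNReal.inv_mul_le_one _)

/-- Integration in a parameter of the truncations of `H` to `{ζ | 1 - t ≤ 2 (1 - |ζ|)}`. -/
theorem lintegral_spreadAverage_indicator_le [SFinite μ] (hH : Measurable H) (z : ℂ) :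
    ∫⁻ t in Set.Icc (0 : ℝ) 1, spreadAverage μ ({ζ | 1 - t ≤ 2 * bdryDist ζ}.indicator H) z ≤
      spreadAverage μ (fun ζ => ENNReal.ofReal (2 * bdryDist ζ) * H ζ) z := by
  have hS : MeasurableSet {x : ℝ × ℂ | 1 - x.1 ≤ 2 * bdryDist x.2} := by
    have := continuous_bdryDist
    exact (isClosed_le (by fun_prop) (by fun_prop)).measurableSet
  have hm : Measurable fun x : ℝ × ℂ =>
      {x : ℝ × ℂ | 1 - x.1 ≤ 2 * bdryDist x.2}.indicator (fun x => H x.2) x /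
        μ (ball x.2 (4 * bdryDist x.2)) :=
    ((hH.comp measurable_snd).indicator hS).div
      (measurable_measure_ball_bdryDist.comp measurable_snd)
  have h : ∀ t ζ, {ζ | 1 - t ≤ 2 * bdryDist ζ}.indicator H ζ =
      {x : ℝ × ℂ | 1 - x.1 ≤ 2 * bdryDist x.2}.indicator (fun x => H x.2) (t, ζ) :=
    fun t ζ => rfl
  simp only [spreadAverage]
  simp only [h]
  rw [lintegral_lintegral_swap hm.aemeasurable]
  refine lintegral_mono fun ζ => ?_
  have h' : ∀ t, {x : ℝ × ℂ | 1 - x.1 ≤ 2 * bdryDist x.2}.indicator (fun x => H x.2) (t, ζ) /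
      μ (ball ζ (4 * bdryDist ζ)) =
      (Set.Ici (1 - 2 * bdryDist ζ)).indicator
        (fun _ => H ζ / μ (ball ζ (4 * bdryDist ζ))) t := by
    intro t
    by_cases ht : 1 - t ≤ 2 * bdryDist ζ
    · rw [Set.indicator_of_mem (by exact ht),
        Set.indicator_of_mem (by rw [Set.mem_Ici]; linarith)]
    · rw [Set.indicator_of_notMem (by exact ht),
        Set.indicator_of_notMem (by rw [Set.mem_Ici]; intro h; exact ht (by linarith)),
        ENNReal.zero_div]
  simp only [h']
  rw [lintegral_indicator_const measurableSet_Ici, Measure.restrict_apply measurableSet_Ici,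
    mul_comm, mul_div_assoc]
  refine mul_le_mul_left ?_ _
  -- The parameters `t ≤ 1` that keep `ζ` in the truncation fill an interval of length at most
  -- `2δ(ζ)`.
  refine (measure_mono (t := Set.Icc (1 - 2 * bdryDist ζ) 1) fun t ht => ⟨ht.1, ht.2.2⟩).trans ?_
  rw [Real.volume_Icc]
  exact ENNReal.ofReal_le_ofReal (by linarith)

end spreadAverage

/-! ### Pointwise domination along radii -/

/-- The sub-mean value property of `G` to the power `1 / q` on hyperbolic discs. -/
def HasSubmeanRoot (q : ℝ) (G : ℂ → ℝ≥0∞) : Prop :=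
  ∀ u ∈ ball (0 : ℂ) 1, G u ^ q⁻¹ * volume (ball u (bdryDist u / 2)) ≤
    ∫⁻ z in ball u (bdryDist u / 2), G z ^ q⁻¹

theorem real_mul_mem_ball {z : ℂ} (hz : z ∈ ball (0 : ℂ) 1) {t : ℝ} (ht : t ∈ Set.Icc (0 : ℝ) 1) :
    (t : ℂ) * z ∈ ball (0 : ℂ) 1 := by
  rw [mem_ball_zero_iff] at *
  rw [norm_mul, Complex.norm_real, Real.norm_of_nonneg ht.1]
  nlinarith [ht.2, norm_nonneg z]

namespace IsBekolleBonami

variable {q : ℝ} {w : ℂ → ℝ≥0}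

/-- With `u = tz` one has `|z - u| ≤ δ(u)`, and `δ(u)/2 < δ(ζ) < 3δ(u)/2` for `ζ` in `B(u, δ(u)/2)`.
Hence the averaging balls of these `ζ` reach `z` and lie in `B(u, 7δ(u))`. -/
theorem exists_le_spreadAverage (hq : 1 < q) (hw : IsBekolleBonami q w)
    (h0 : weightedArea w ≠ 0) :
    ∃ C : ℝ≥0, ∀ G : ℂ → ℝ≥0∞, Measurable G → HasSubmeanRoot q G →
      ∀ z ∈ ball (0 : ℂ) 1, ∀ t ∈ Set.Icc (0 : ℝ) 1,
      G (t * z) ≤ C * spreadAverage (weightedArea w)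
        ({ζ | 1 - t * ‖z‖ ≤ 2 * bdryDist ζ}.indicator G) z := by
  obtain ⟨C, hC⟩ := hw.exists_mul_weightedArea_le hq h0
  have := hw.isFiniteMeasure hq
  refine ⟨C, fun G hG hsub z hz t ht => ?_⟩
  set u : ℂ := t * z
  have hu : u ∈ ball (0 : ℂ) 1 := real_mul_mem_ball hz ht
  have hδ := bdryDist_pos hu
  have hδu : bdryDist u = 1 - t * ‖z‖ := by
    rw [bdryDist, norm_mul, Complex.norm_real, Real.norm_of_nonneg ht.1]
  have hzu : dist z u ≤ bdryDist u := by
    rw [mem_ball_zero_iff] at hz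
    rw [dist_eq_norm, hδu, show z - u = ((1 - t : ℝ) : ℂ) * z by push_cast; ring, norm_mul,
      Complex.norm_real, Real.norm_of_nonneg (by linarith [ht.2])]
    linarith
  have hμ0 : weightedArea w (ball u (7 * bdryDist u)) ≠ 0 := by
    intro h
    have hac : volume.restrict (ball (0 : ℂ) 1) ≪ weightedArea w :=
      withDensity_absolutelyContinuous' hw.aemeasurable.coe_nnreal_ennreal (hw.ae_ne_zero hq h0)
    have h1 := hac h
    rw [Measure.restrict_apply measurableSet_ball] at h1
    refine (measure_ball_pos volume u (half_pos hδ)).ne' (measure_mono_null ?_ h1)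
    exact Set.subset_inter (ball_subset_ball (by linarith)) (ball_half_bdryDist_subset u)
  have h := hC G hG u hu (hsub u hu)
  rw [← ENNReal.le_div_iff_mul_le (Or.inl hμ0) (Or.inl (measure_ne_top _ _)), mul_div_assoc] at h
  refine h.trans (mul_le_mul_right ?_ _)
  rw [div_eq_mul_inv, ← lintegral_mul_const' _ _ (ENNReal.inv_ne_top.2 hμ0)]
  calc ∫⁻ ζ in ball u (bdryDist u / 2), G ζ * (weightedArea w (ball u (7 * bdryDist u)))⁻¹
          ∂weightedArea w
      ≤ ∫⁻ ζ in ball u (bdryDist u / 2), {ζ | 1 - t * ‖z‖ ≤ 2 * bdryDist ζ}.indicator G ζ /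
          weightedArea w (ball ζ (4 * bdryDist ζ)) ∂weightedArea w := by
        refine setLIntegral_mono' measurableSet_ball fun ζ hζ => ?_
        rw [mem_ball] at hζ
        have h1 := bdryDist_le_add_dist u ζ
        have h2 := bdryDist_le_add_dist ζ u
        rw [dist_comm] at h1
        have hmem : ζ ∈ {ζ | 1 - t * ‖z‖ ≤ 2 * bdryDist ζ} := by
          rw [Set.mem_ofPred_eq]; linarith
        rw [Set.indicator_of_mem hmem, div_eq_mul_inv]
        refine mul_le_mul_right (ENNReal.inv_le_inv.2 (measure_mono ?_)) _
        -- The radius 7 suffices because `4 * (3/2) + 1/2 < 7`.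
        exact ball_subset_ball' (by linarith)
    _ ≤ _ := by
        refine lintegral_mono_set fun ζ hζ => ?_
        rw [mem_ball] at hζ
        have h1 := bdryDist_le_add_dist u ζ
        have h3 := dist_triangle z u ζ
        rw [dist_comm u ζ] at h1 h3
        show dist z ζ < 4 * bdryDist ζ
        linarith

end IsBekolleBonami

/-! ### Analytic functions along radii -/

section analytic

variable {f g : ℂ → ℂ}

theorem DifferentiableOn.measurable_indicator_rpow_mul_rpow
    (hf : DifferentiableOn ℂ f (ball 0 1)) (hg : DifferentiableOn ℂ g (ball 0 1))
    {a b : ℝ} (ha : 0 < a) (hb : 0 < b) :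
    Measurable ((ball (0 : ℂ) 1).indicator fun z => ‖f z‖ₑ ^ a * ‖g z‖ₑ ^ b) := by
  simp only [← enorm_rpow_mul_rpow _ _ ha.le hb.le]
  exact ContinuousOn.measurable_indicator
    ((hf.continuousOn.norm.rpow_const fun _ _ => Or.inr ha.le).mul
      (hg.continuousOn.norm.rpow_const fun _ _ => Or.inr hb.le)).enorm measurableSet_ball

theorem DifferentiableOn.hasSubmeanRoot_rpow_mul_rpow
    (hf : DifferentiableOn ℂ f (ball 0 1)) (hg : DifferentiableOn ℂ g (ball 0 1))
    {a b q : ℝ} (ha : 0 < a) (hb : 0 < b) (hq : 0 < q) :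
    HasSubmeanRoot q ((ball (0 : ℂ) 1).indicator fun z => ‖f z‖ₑ ^ a * ‖g z‖ₑ ^ b) := by
  intro u hu
  have hs := ball_half_bdryDist_subset u
  have hpow : ∀ z ∈ ball (0 : ℂ) 1,
      (ball (0 : ℂ) 1).indicator (fun z => ‖f z‖ₑ ^ a * ‖g z‖ₑ ^ b) z ^ q⁻¹ =
        ‖f z‖ₑ ^ (a * q⁻¹) * ‖g z‖ₑ ^ (b * q⁻¹) := by
    intro z hz
    rw [Set.indicator_of_mem hz, ENNReal.mul_rpow_of_nonneg _ _ (by positivity),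
      ENNReal.rpow_mul, ENNReal.rpow_mul]
  rw [hpow u hu, setLIntegral_congr_fun measurableSet_ball fun z hz => hpow z (hs hz)]
  exact ((hf.analyticOnNhd isOpen_ball).mono hs).rpow_mul_rpow_le_lintegral_ball
    ((hg.analyticOnNhd isOpen_ball).mono hs) (by positivity) (by positivity)

theorem DifferentiableOn.hasDerivAt_comp_real_mul (hf : DifferentiableOn ℂ f (ball 0 1))
    {z : ℂ} (hz : z ∈ ball (0 : ℂ) 1) {t : ℝ} (ht : t ∈ Set.Icc (0 : ℝ) 1) :
    HasDerivAt (fun s : ℝ => f (s * z)) (_root_.deriv f (t * z) * z) t := by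
  have h1 := (hf.differentiableAt (isOpen_ball.mem_nhds (real_mul_mem_ball hz ht))).hasDerivAt
  have h2 : HasDerivAt (fun s : ℝ => (s : ℂ) * z) (1 * z) t :=
    (HasDerivAt.ofReal_comp (hasDerivAt_id t)).mul_const z
  rw [one_mul] at h2
  exact h1.comp t h2

theorem DifferentiableOn.contDiffOn_comp_real_mul (hf : DifferentiableOn ℂ f (ball 0 1))
    {z : ℂ} (hz : z ∈ ball (0 : ℂ) 1) :
    ContDiffOn ℝ 1 (fun s : ℝ => f (s * z)) (Set.Icc 0 1) := by
  have h1 : ContDiffOn ℝ 1 f (ball 0 1) :=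
    (hf.contDiffOn (n := 1) isOpen_ball).restrict_scalars ℝ
  have h2 : ContDiff ℝ 1 fun s : ℝ => (s : ℂ) * z :=
    Complex.ofRealCLM.contDiff.mul contDiff_const
  exact h1.comp h2.contDiffOn fun t ht => real_mul_mem_ball hz ht

theorem enorm_le_one_of_mem_ball {z : ℂ} (hz : z ∈ ball (0 : ℂ) 1) : ‖z‖ₑ ≤ 1 := by
  rw [mem_ball_zero_iff] at hz
  rw [← ofReal_norm]
  exact ENNReal.ofReal_le_one.2 hz.le

/-- Radial integration of the derivative of `‖f‖ ^ p`. -/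
theorem DifferentiableOn.enorm_rpow_le_lintegral (hf : DifferentiableOn ℂ f (ball 0 1))
    (h0 : f 0 = 0) {p : ℝ} (hp : 1 < p) {z : ℂ} (hz : z ∈ ball (0 : ℂ) 1) :
    ‖f z‖ₑ ^ p ≤ ENNReal.ofReal p * ∫⁻ t in Set.Icc (0 : ℝ) 1,
      ‖f ((t : ℝ) * z)‖ₑ ^ (p - 1) * ‖_root_.deriv f ((t : ℝ) * z)‖ₑ ^ (1 : ℝ) := by
  have hφ : ContDiffOn ℝ 1 (fun s : ℝ => ‖f (s * z)‖ ^ p) (Set.Icc 0 1) :=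
    (contDiff_norm_rpow (E := ℂ) hp).comp_contDiffOn (hf.contDiffOn_comp_real_mul hz)
  have h := enorm_sub_le_lintegral_deriv_of_contDiffOn_Icc hφ zero_le_one
  have hp0 : 0 < p := by linarith
  simp only [Complex.ofReal_one, one_mul, Complex.ofReal_zero, zero_mul, h0, norm_zero,
    Real.zero_rpow hp0.ne', sub_zero, Real.enorm_rpow_of_nonneg (norm_nonneg _) hp0.le,
    enorm_norm] at h
  refine h.trans ?_
  rw [← lintegral_const_mul' _ _ ENNReal.ofReal_ne_top]
  refine setLIntegral_mono' measurableSet_Icc fun t ht => ?_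
  have hd : HasDerivAt (fun s : ℝ => ‖f (s * z)‖ ^ p)
      (fderiv ℝ (fun x : ℂ => ‖x‖ ^ p) (f (t * z)) (_root_.deriv f (t * z) * z)) t :=
    (differentiable_norm_rpow hp _).hasFDerivAt.comp_hasDerivAt t
      (hf.hasDerivAt_comp_real_mul hz ht)
  rw [hd.deriv]
  refine (ContinuousLinearMap.le_opENorm _ _).trans ?_
  have he : ‖fderiv ℝ (fun x : ℂ => ‖x‖ ^ p) (f (t * z))‖ₑ =
      ENNReal.ofReal p * ‖f (t * z)‖ₑ ^ (p - 1) := by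
    rw [← ofReal_norm, norm_fderiv_norm_id_rpow _ hp, ENNReal.ofReal_mul hp0.le,
      ← ENNReal.ofReal_rpow_of_nonneg (norm_nonneg _) (by linarith), ofReal_norm]
  rw [he, enorm_mul, ENNReal.rpow_one, mul_assoc]
  gcongr
  exact mul_le_of_le_one_right' (enorm_le_one_of_mem_ball hz)

theorem DifferentiableOn.aemeasurable_enorm (hf : DifferentiableOn ℂ f (ball 0 1)) (w : ℂ → ℝ≥0) :
    AEMeasurable (fun z => ‖f z‖ₑ) (weightedArea w) := by
  refine ⟨_, hf.continuousOn.enorm.measurable_indicator measurableSet_ball, ?_⟩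
  filter_upwards [ae_weightedArea_mem_ball w] with z hz
  rw [Set.indicator_of_mem hz]

end analytic

/-! ### The case `p > 1` under a finiteness assumption -/

namespace IsBekolleBonami

variable {q : ℝ} {w : ℂ → ℝ≥0}

theorem exists_lintegral_rpow_le_lintegral_mul_deriv (hq : 1 < q) (hw : IsBekolleBonami q w)
    (h0 : weightedArea w ≠ 0) {p : ℝ} (hp : 1 < p) :
    ∃ C : ℝ≥0, ∀ h : ℂ → ℂ, DifferentiableOn ℂ h (ball 0 1) → h 0 = 0 →
      ∫⁻ z, ‖h z‖ₑ ^ p ∂weightedArea w ≤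
        C * ∫⁻ z, ‖h z‖ₑ ^ (p - 1) * (‖deriv h z‖ₑ * ENNReal.ofReal (bdryDist z))
          ∂weightedArea w := by
  obtain ⟨C, hC⟩ := hw.exists_le_spreadAverage hq h0
  have := hw.isFiniteMeasure hq
  refine ⟨p.toNNReal * (C * 2), fun h hh hh0 => ?_⟩
  have hd : DifferentiableOn ℂ (deriv h) (ball 0 1) := hh.deriv isOpen_ball
  have hp1 : 0 < p - 1 := by linarith
  set G : ℂ → ℝ≥0∞ :=
    (ball (0 : ℂ) 1).indicator fun z => ‖h z‖ₑ ^ (p - 1) * ‖deriv h z‖ₑ ^ (1 : ℝ) with hGdef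
  have hG : Measurable G := hh.measurable_indicator_rpow_mul_rpow hd hp1 one_pos
  have hGs : HasSubmeanRoot q G := hh.hasSubmeanRoot_rpow_mul_rpow hd hp1 one_pos (by linarith)
  have hδ : Measurable fun ζ => ENNReal.ofReal (2 * bdryDist ζ) :=
    (continuous_bdryDist.measurable.const_mul 2).ennreal_ofReal
  have hpt : ∀ z ∈ ball (0 : ℂ) 1, ‖h z‖ₑ ^ p ≤ ENNReal.ofReal p * (C *
      spreadAverage (weightedArea w) (fun ζ => ENNReal.ofReal (2 * bdryDist ζ) * G ζ) z) := by
    intro z hz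
    refine (hh.enorm_rpow_le_lintegral hh0 hp hz).trans (mul_le_mul_right ?_ _)
    refine le_trans ?_ (mul_le_mul_right (lintegral_spreadAverage_indicator_le hG z) _)
    rw [← lintegral_const_mul' _ _ ENNReal.coe_ne_top]
    refine setLIntegral_mono' measurableSet_Icc fun t ht => ?_
    have h1 := hC G hG hGs z hz t ht
    rw [hGdef, Set.indicator_of_mem (real_mul_mem_ball hz ht), ← hGdef] at h1
    -- As `|z| < 1`, the condition `1 - t|z| ≤ 2δ(ζ)` implies `1 - t ≤ 2δ(ζ)`, which no longer
    -- involves `z`.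
    refine h1.trans (mul_le_mul_right (spreadAverage_mono (fun ζ _ => ?_) z) _)
    refine Set.indicator_le_indicator_of_subset (fun ζ hζ => ?_) (fun _ => zero_le) ζ
    rw [Set.mem_ofPred_eq] at hζ ⊢
    rw [mem_ball_zero_iff] at hz
    nlinarith [ht.1]
  calc ∫⁻ z, ‖h z‖ₑ ^ p ∂weightedArea w
      ≤ ∫⁻ z, ENNReal.ofReal p * (C * spreadAverage (weightedArea w)
          (fun ζ => ENNReal.ofReal (2 * bdryDist ζ) * G ζ) z) ∂weightedArea w := by
        refine lintegral_mono_ae ?_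
        filter_upwards [ae_weightedArea_mem_ball w] with z hz using hpt z hz
    _ = ENNReal.ofReal p * (C * ∫⁻ z, spreadAverage (weightedArea w)
          (fun ζ => ENNReal.ofReal (2 * bdryDist ζ) * G ζ) z ∂weightedArea w) := by
        rw [lintegral_const_mul' _ _ ENNReal.ofReal_ne_top,
          lintegral_const_mul' _ _ ENNReal.coe_ne_top]
    _ ≤ ENNReal.ofReal p * (C * ∫⁻ ζ, ENNReal.ofReal (2 * bdryDist ζ) * G ζ ∂weightedArea w) :=
        mul_le_mul_right (mul_le_mul_right (lintegral_spreadAverage_le (hδ.mul hG)) _) _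
    _ = ENNReal.ofReal p * (C * ∫⁻ z, 2 * (‖h z‖ₑ ^ (p - 1) *
          (‖deriv h z‖ₑ * ENNReal.ofReal (bdryDist z))) ∂weightedArea w) := by
        congr 2
        refine lintegral_congr_ae ?_
        filter_upwards [ae_weightedArea_mem_ball w] with z hz
        rw [hGdef, Set.indicator_of_mem hz, ENNReal.ofReal_mul two_pos.le, ENNReal.rpow_one,
          ENNReal.ofReal_ofNat]
        ring
    _ = _ := by
        rw [lintegral_const_mul' _ _ ENNReal.ofNat_ne_top, ENNReal.ofReal]
        push_cast
        ring

/-- Hölder with exponents `p/(p-1)` and `p` leaves `I ^ ((p-1)/p)` on the right, and finiteness of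
`I` allows cancelling it. -/
theorem exists_lintegral_rpow_le_of_ne_top (hq : 1 < q) (hw : IsBekolleBonami q w)
    (h0 : weightedArea w ≠ 0) {p : ℝ} (hp : 1 < p) :
    ∃ C : ℝ≥0, ∀ h : ℂ → ℂ, DifferentiableOn ℂ h (ball 0 1) → h 0 = 0 →
      ∫⁻ z, ‖h z‖ₑ ^ p ∂weightedArea w ≠ ∞ →
      ∫⁻ z, ‖h z‖ₑ ^ p ∂weightedArea w ≤
        C * ∫⁻ z, (‖deriv h z‖ₑ * ENNReal.ofReal (bdryDist z)) ^ p ∂weightedArea w := by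
  obtain ⟨C, hC⟩ := hw.exists_lintegral_rpow_le_lintegral_mul_deriv hq h0 hp
  refine ⟨C ^ p, fun h hh hh0 hfin => ?_⟩
  have hp0 : 0 < p := by linarith
  have hp1 : 0 < p - 1 := by linarith
  set I := ∫⁻ z, ‖h z‖ₑ ^ p ∂weightedArea w
  set A := ∫⁻ z, (‖deriv h z‖ₑ * ENNReal.ofReal (bdryDist z)) ^ p ∂weightedArea w
  rcases eq_or_ne I 0 with hI | hI
  · rw [hI]; exact zero_le
  have hconj : (p / (p - 1)).HolderConjugate p :=
    (Real.HolderConjugate.conjExponent hp).symm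
  have hhm := hh.aemeasurable_enorm w
  have hdm := (hh.deriv isOpen_ball).aemeasurable_enorm w
  have hδ : Measurable fun z => ENNReal.ofReal (bdryDist z) :=
    continuous_bdryDist.measurable.ennreal_ofReal
  have hH := ENNReal.lintegral_mul_le_Lp_mul_Lq (weightedArea w) hconj
    (hhm.pow_const (p - 1)) (hdm.mul hδ.aemeasurable)
  simp only [Pi.mul_apply, ← ENNReal.rpow_mul, mul_div_cancel₀ p hp1.ne', one_div_div] at hH
  have h1 : I ≤ C * A ^ p⁻¹ * I ^ ((p - 1) / p) := by
    refine (hC h hh hh0).trans ((mul_le_mul_right hH _).trans (le_of_eq ?_))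
    rw [one_div]
    ring
  have h2 : I = I ^ p⁻¹ * I ^ ((p - 1) / p) := by
    rw [← ENNReal.rpow_add _ _ hI hfin, show p⁻¹ + (p - 1) / p = 1 by field_simp; ring,
      ENNReal.rpow_one]
  have h3 : I ^ p⁻¹ ≤ C * A ^ p⁻¹ := by
    refine (ENNReal.mul_le_mul_iff_left ?_ ?_).1 (h2.symm.le.trans h1)
    · exact (ENNReal.rpow_pos (pos_iff_ne_zero.2 hI) hfin).ne'
    · exact ENNReal.rpow_ne_top_of_nonneg (by positivity) hfin
  have h4 := ENNReal.rpow_le_rpow h3 hp0.le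
  rwa [ENNReal.mul_rpow_of_nonneg _ _ hp0.le, ← ENNReal.rpow_mul, ← ENNReal.rpow_mul,
    inv_mul_cancel₀ hp0.ne', ENNReal.rpow_one, ENNReal.rpow_one,
    ← ENNReal.coe_rpow_of_nonneg _ hp0.le] at h4

end IsBekolleBonami

/-! ### Dilations, Fatou's lemma and truncated geometric sums -/

theorem DifferentiableOn.comp_real_mul {f : ℂ → ℂ} (hf : DifferentiableOn ℂ f (ball 0 1)) {r : ℝ}
    (hr : r ∈ Set.Icc (0 : ℝ) 1) : DifferentiableOn ℂ (fun z => f (r * z)) (ball 0 1) :=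
  hf.comp (by fun_prop) fun _ hz => real_mul_mem_ball hz hr

/-- The constant function 1 as second factor lets the two-factor results cover `|f'| ^ p`. -/
theorem deriv_rpow_indicator_eq (f : ℂ → ℂ) (p : ℝ) :
    ((ball (0 : ℂ) 1).indicator fun z => ‖deriv f z‖ₑ ^ p * ‖(1 : ℂ)‖ₑ ^ (1 : ℝ)) =
      (ball (0 : ℂ) 1).indicator fun z => ‖deriv f z‖ₑ ^ p := by
  simp

theorem measurable_indicator_deriv_rpow {f : ℂ → ℂ} (hf : DifferentiableOn ℂ f (ball 0 1))
    {p : ℝ} (hp : 0 < p) :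
    Measurable ((ball (0 : ℂ) 1).indicator fun z => ‖deriv f z‖ₑ ^ p) :=
  deriv_rpow_indicator_eq f p ▸ (hf.deriv isOpen_ball).measurable_indicator_rpow_mul_rpow
    (differentiableOn_const (1 : ℂ)) hp one_pos

theorem hasSubmeanRoot_indicator_deriv_rpow {f : ℂ → ℂ} (hf : DifferentiableOn ℂ f (ball 0 1))
    {p q : ℝ} (hp : 0 < p) (hq : 0 < q) :
    HasSubmeanRoot q ((ball (0 : ℂ) 1).indicator fun z => ‖deriv f z‖ₑ ^ p) :=
  deriv_rpow_indicator_eq f p ▸ (hf.deriv isOpen_ball).hasSubmeanRoot_rpow_mul_rpow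
    (differentiableOn_const (1 : ℂ)) hp one_pos hq

theorem lintegral_indicator_deriv_rpow_mul (w : ℂ → ℝ≥0) (f : ℂ → ℂ) {p : ℝ} (hp : 0 < p) :
    ∫⁻ z, ENNReal.ofReal (2 * bdryDist z) ^ p *
        (ball (0 : ℂ) 1).indicator (fun z => ‖deriv f z‖ₑ ^ p) z ∂weightedArea w =
      2 ^ p * ∫⁻ z, (‖deriv f z‖ₑ * ENNReal.ofReal (bdryDist z)) ^ p ∂weightedArea w := by
  rw [← lintegral_const_mul' _ _ (ENNReal.rpow_ne_top_of_nonneg hp.le ENNReal.ofNat_ne_top)]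
  refine lintegral_congr_ae ?_
  filter_upwards [ae_weightedArea_mem_ball w] with z hz
  rw [Set.indicator_of_mem hz, ENNReal.ofReal_mul two_pos.le, ENNReal.mul_rpow_of_nonneg _ _ hp.le,
    ENNReal.mul_rpow_of_nonneg _ _ hp.le, ENNReal.ofReal_ofNat]
  ring

theorem lintegral_enorm_sub_rpow_le_of_tendsto (w : ℂ → ℝ≥0) {f : ℂ → ℂ}
    (hf : DifferentiableOn ℂ f (ball 0 1)) {p : ℝ} {L : ℝ≥0∞} {r : ℕ → ℝ}
    (hr : ∀ n, r n ∈ Set.Icc (0 : ℝ) 1) (hr1 : Filter.Tendsto r Filter.atTop (nhds 1))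
    (h : ∀ n, ∫⁻ z, ‖f (r n * z) - f 0‖ₑ ^ p ∂weightedArea w ≤ L) :
    ∫⁻ z, ‖f z - f 0‖ₑ ^ p ∂weightedArea w ≤ L := by
  calc ∫⁻ z, ‖f z - f 0‖ₑ ^ p ∂weightedArea w
      = ∫⁻ z, Filter.liminf (fun n => ‖f (r n * z) - f 0‖ₑ ^ p) Filter.atTop
          ∂weightedArea w := by
        refine lintegral_congr_ae ?_
        filter_upwards [ae_weightedArea_mem_ball w] with z hz
        have h1 : Filter.Tendsto (fun n => (r n : ℂ) * z) Filter.atTop (nhds z) := by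
          have := (Complex.continuous_ofReal.tendsto 1).comp hr1
          simpa using this.mul_const z
        have h2 := ((hf.continuousOn.continuousAt (isOpen_ball.mem_nhds hz)).tendsto.comp h1)
        exact ((ENNReal.continuous_rpow_const.tendsto _).comp
          (h2.sub_const (f 0)).enorm).liminf_eq.symm
    _ ≤ Filter.liminf (fun n => ∫⁻ z, ‖f (r n * z) - f 0‖ₑ ^ p ∂weightedArea w)
          Filter.atTop := by
        refine lintegral_liminf_le' fun n => AEMeasurable.pow_const ?_ p
        exact ((hf.comp_real_mul (hr n)).sub_const (f 0)).aemeasurable_enorm w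
    _ ≤ L := by
        refine (Filter.liminf_le_liminf (Filter.Eventually.of_forall h)).trans ?_
        simp

theorem sum_geometric_truncated_le {θ y : ℝ} (hθ : 0 < θ) (hθ1 : θ < 1) (hy : 0 ≤ y) (N : ℕ) :
    ∑ n ∈ Finset.range N, (if θ ^ (n + 1) ≤ y then θ ^ (n + 1) else 0) ≤ y / (1 - θ) := by
  -- The extra term `min y (θ ^ (N + 1))` makes the induction telescope, since `θ ^ (n + 1) * (1 -
  -- θ) = θ ^ (n + 1) - θ ^ (n + 2)`.
  have key : (∑ n ∈ Finset.range N, (if θ ^ (n + 1) ≤ y then θ ^ (n + 1) else 0)) * (1 - θ) +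
      min y (θ ^ (N + 1)) ≤ y := by
    induction N with
    | zero => simp
    | succ N ih =>
      have hle : θ ^ (N + 1 + 1) ≤ θ ^ (N + 1) :=
        pow_le_pow_of_le_one hθ.le hθ1.le (Nat.le_succ _)
      rw [Finset.sum_range_succ]
      split_ifs with h
      · rw [min_eq_right h] at ih
        rw [min_eq_right (hle.trans h), pow_succ θ (N + 1)]
        linarith
      · rw [add_zero]
        exact (add_le_add_right (min_le_min_left y hle) _).trans ih
  rw [le_div_iff₀ (by linarith)]
  have : 0 ≤ min y (θ ^ (N + 1)) := le_min hy (by positivity)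
  linarith

theorem sum_dyadic_rpow_indicator_le {p x : ℝ} (hp : 0 < p) (hx : 0 ≤ x) (N : ℕ) :
    ∑ n ∈ Finset.range N, (if (2⁻¹ : ℝ) ^ (n + 1) ≤ x then
      ENNReal.ofReal ((2⁻¹ : ℝ) ^ (n + 1)) ^ p else 0) ≤
      ENNReal.ofReal (1 / (1 - (2⁻¹ : ℝ) ^ p)) * ENNReal.ofReal x ^ p := by
  have hθ : 0 < (2⁻¹ : ℝ) ^ p := by positivity
  have hθ1 : (2⁻¹ : ℝ) ^ p < 1 := Real.rpow_lt_one (by norm_num) (by norm_num) hp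
  have hpow : ∀ n : ℕ, ((2⁻¹ : ℝ) ^ (n + 1)) ^ p = ((2⁻¹ : ℝ) ^ p) ^ (n + 1) := by
    intro n
    rw [← Real.rpow_natCast, ← Real.rpow_mul (by norm_num), mul_comm, Real.rpow_mul (by norm_num),
      Real.rpow_natCast]
  have h := ENNReal.ofReal_le_ofReal
    (sum_geometric_truncated_le hθ hθ1 (Real.rpow_nonneg hx p) N)
  rw [ENNReal.ofReal_sum_of_nonneg (fun n _ => by split_ifs <;> positivity)] at h
  rw [ENNReal.ofReal_rpow_of_nonneg hx hp.le,
    ← ENNReal.ofReal_mul (one_div_nonneg.2 (by linarith)), one_div_mul_eq_div]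
  refine le_trans (Finset.sum_le_sum fun n _ => ?_) h
  rw [← hpow]
  have hiff : ((2⁻¹ : ℝ) ^ (n + 1)) ^ p ≤ x ^ p ↔ (2⁻¹ : ℝ) ^ (n + 1) ≤ x :=
    Real.rpow_le_rpow_iff (by positivity) hx hp
  by_cases hn : (2⁻¹ : ℝ) ^ (n + 1) ≤ x
  · rw [if_pos hn, if_pos (hiff.2 hn), ENNReal.ofReal_rpow_of_nonneg (by positivity) hp.le]
  · rw [if_neg hn]; exact zero_le

theorem one_sub_half_pow_mem_Icc (n : ℕ) : 1 - (2⁻¹ : ℝ) ^ n ∈ Set.Icc (0 : ℝ) 1 :=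
  ⟨sub_nonneg.2 (pow_le_one₀ (by norm_num) (by norm_num)), sub_le_self _ (by positivity)⟩

theorem tendsto_one_sub_half_pow :
    Filter.Tendsto (fun n : ℕ => 1 - (2⁻¹ : ℝ) ^ n) Filter.atTop (nhds 1) := by
  simpa using (tendsto_pow_atTop_nhds_zero_of_lt_one (r := (2⁻¹ : ℝ))
    (by norm_num) (by norm_num)).const_sub 1

/-! ### The inequality for `p > 1` and for `p ≤ 1` -/

namespace IsBekolleBonami

variable {q : ℝ} {w : ℂ → ℝ≥0}

/-- Uniformity in `r` is what the passage to the limit `r → 1` needs. On the truncation set `δ(z) ≤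
1 - r|z| ≤ 2δ(ζ)`, so the weight `δ(z) ^ p` moves inside the average. -/
theorem exists_lintegral_deriv_comp_mul_le (hq : 1 < q) (hw : IsBekolleBonami q w)
    (h0 : weightedArea w ≠ 0) {p : ℝ} (hp : 0 < p) :
    ∃ C : ℝ≥0, ∀ f : ℂ → ℂ, DifferentiableOn ℂ f (ball 0 1) → ∀ r ∈ Set.Icc (0 : ℝ) 1,
      ∫⁻ z, (‖deriv f ((r : ℝ) * z)‖ₑ * ENNReal.ofReal (bdryDist z)) ^ p ∂weightedArea w ≤
        C * ∫⁻ z, (‖deriv f z‖ₑ * ENNReal.ofReal (bdryDist z)) ^ p ∂weightedArea w := by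
  obtain ⟨C, hC⟩ := hw.exists_le_spreadAverage hq h0
  have := hw.isFiniteMeasure hq
  refine ⟨C * 2 ^ p, fun f hf r hr => ?_⟩
  set G : ℂ → ℝ≥0∞ := (ball (0 : ℂ) 1).indicator fun z => ‖deriv f z‖ₑ ^ p with hGdef
  have hG : Measurable G := measurable_indicator_deriv_rpow hf hp
  have hGs : HasSubmeanRoot q G := hasSubmeanRoot_indicator_deriv_rpow hf hp (by linarith)
  have hδ : Measurable fun ζ => ENNReal.ofReal (2 * bdryDist ζ) ^ p :=
    (continuous_bdryDist.measurable.const_mul 2).ennreal_ofReal.pow_const p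
  have hpt : ∀ z ∈ ball (0 : ℂ) 1,
      (‖deriv f ((r : ℝ) * z)‖ₑ * ENNReal.ofReal (bdryDist z)) ^ p ≤
        C * spreadAverage (weightedArea w)
          (fun ζ => ENNReal.ofReal (2 * bdryDist ζ) ^ p * G ζ) z := by
    intro z hz
    have h1 := hC G hG hGs z hz r hr
    rw [hGdef, Set.indicator_of_mem (real_mul_mem_ball hz hr), ← hGdef] at h1
    rw [ENNReal.mul_rpow_of_nonneg _ _ hp.le, mul_comm]
    refine (mul_le_mul_right h1 _).trans ?_
    rw [mul_left_comm, ← spreadAverage_const_mul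
      (ENNReal.rpow_ne_top_of_nonneg hp.le ENNReal.ofReal_ne_top)]
    refine mul_le_mul_right (spreadAverage_mono (fun ζ _ => ?_) z) _
    by_cases hζ : 1 - r * ‖z‖ ≤ 2 * bdryDist ζ
    · rw [Set.indicator_of_mem (show ζ ∈ {ζ | 1 - r * ‖z‖ ≤ 2 * bdryDist ζ} from hζ)]
      refine mul_le_mul_left (ENNReal.rpow_le_rpow (ENNReal.ofReal_le_ofReal ?_) hp.le) _
      refine le_trans ?_ hζ
      rw [bdryDist]
      nlinarith [hr.2, norm_nonneg z]
    · rw [Set.indicator_of_notMem (show ζ ∉ {ζ | 1 - r * ‖z‖ ≤ 2 * bdryDist ζ} from hζ), mul_zero]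
      exact zero_le
  calc ∫⁻ z, (‖deriv f ((r : ℝ) * z)‖ₑ * ENNReal.ofReal (bdryDist z)) ^ p ∂weightedArea w
      ≤ ∫⁻ z, C * spreadAverage (weightedArea w)
          (fun ζ => ENNReal.ofReal (2 * bdryDist ζ) ^ p * G ζ) z ∂weightedArea w := by
        refine lintegral_mono_ae ?_
        filter_upwards [ae_weightedArea_mem_ball w] with z hz using hpt z hz
    _ ≤ C * ∫⁻ ζ, ENNReal.ofReal (2 * bdryDist ζ) ^ p * G ζ ∂weightedArea w := by
        rw [lintegral_const_mul' _ _ ENNReal.coe_ne_top]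
        exact mul_le_mul_right (lintegral_spreadAverage_le (hδ.mul hG)) _
    _ = _ := by
        rw [hGdef, lintegral_indicator_deriv_rpow_mul w f hp, ENNReal.coe_mul,
          ENNReal.coe_rpow_of_nonneg _ hp.le]
        push_cast
        ring

/-- For `r < 1` the dilate `f(rz)` is bounded on the disc and `μ` is finite, so the conditional
inequality applies to it. -/
theorem exists_lintegral_rpow_le_of_one_lt (hq : 1 < q) (hw : IsBekolleBonami q w)
    (h0 : weightedArea w ≠ 0) {p : ℝ} (hp : 1 < p) :
    ∃ C : ℝ≥0, ∀ f : ℂ → ℂ, DifferentiableOn ℂ f (ball 0 1) →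
      ∫⁻ z, ‖f z - f 0‖ₑ ^ p ∂weightedArea w ≤
        C * ∫⁻ z, (‖deriv f z‖ₑ * ENNReal.ofReal (bdryDist z)) ^ p ∂weightedArea w := by
  have hp0 : 0 < p := by linarith
  obtain ⟨C, hC⟩ := hw.exists_lintegral_rpow_le_of_ne_top hq h0 hp
  obtain ⟨C', hC'⟩ := hw.exists_lintegral_deriv_comp_mul_le hq h0 hp0
  have := hw.isFiniteMeasure hq
  refine ⟨C * C', fun f hf => lintegral_enorm_sub_rpow_le_of_tendsto w hf
    one_sub_half_pow_mem_Icc tendsto_one_sub_half_pow fun n => ?_⟩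
  have hr := one_sub_half_pow_mem_Icc n
  have hr1 : 1 - (2⁻¹ : ℝ) ^ n < 1 := sub_lt_self _ (by positivity)
  set r : ℝ := 1 - (2⁻¹ : ℝ) ^ n
  have hg : DifferentiableOn ℂ (fun z => f (r * z) - f 0) (ball 0 1) :=
    (hf.comp_real_mul hr).sub_const (f 0)
  have hbdd : ∃ M : ℝ, ∀ z ∈ ball (0 : ℂ) 1, ‖f (r * z) - f 0‖ ≤ M := by
    have hc : ContinuousOn (fun z => f (r * z) - f 0) (closedBall 0 1) := by
      refine (hf.continuousOn.comp (by fun_prop) fun z hz => ?_).sub continuousOn_const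
      rw [mem_closedBall_zero_iff] at hz
      rw [mem_ball_zero_iff, norm_mul, Complex.norm_real, Real.norm_of_nonneg hr.1]
      nlinarith [hr.1]
    obtain ⟨M, hM⟩ := (isCompact_closedBall (0 : ℂ) 1).exists_bound_of_continuousOn hc
    exact ⟨M, fun z hz => hM z (ball_subset_closedBall hz)⟩
  obtain ⟨M, hM⟩ := hbdd
  have hfin : ∫⁻ z, ‖f (r * z) - f 0‖ₑ ^ p ∂weightedArea w ≠ ∞ := by
    refine ne_top_of_le_ne_top (b := ∫⁻ _, ENNReal.ofReal M ^ p ∂weightedArea w) ?_ ?_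
    · rw [lintegral_const]
      exact ENNReal.mul_ne_top (ENNReal.rpow_ne_top_of_nonneg hp0.le ENNReal.ofReal_ne_top)
        (measure_ne_top _ _)
    · refine lintegral_mono_ae ?_
      filter_upwards [ae_weightedArea_mem_ball w] with z hz
      refine ENNReal.rpow_le_rpow ?_ hp0.le
      rw [← ofReal_norm]
      exact ENNReal.ofReal_le_ofReal (hM z hz)
  refine (hC _ hg (by simp) hfin).trans ?_
  rw [ENNReal.coe_mul, mul_assoc]
  refine mul_le_mul_right (le_trans (lintegral_mono_ae ?_) (hC' f hf r hr)) _
  filter_upwards [ae_weightedArea_mem_ball w] with z hz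
  refine ENNReal.rpow_le_rpow (mul_le_mul_left ?_ _) hp0.le
  have hd : HasDerivAt (fun z => f (r * z) - f 0) (deriv f (r * z) * r) z := by
    have h1 := (hf.differentiableAt (isOpen_ball.mem_nhds (real_mul_mem_ball hz hr))).hasDerivAt
    have h2 : HasDerivAt (fun z : ℂ => (r : ℂ) * z) r z := by
      simpa using (hasDerivAt_id z).const_mul (r : ℂ)
    exact (h1.comp z h2).sub_const (f 0)
  rw [hd.deriv, enorm_mul]
  refine mul_le_of_le_one_right' ?_
  rw [← ofReal_norm, Complex.norm_real, Real.norm_of_nonneg hr.1]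
  exact ENNReal.ofReal_le_one.2 hr.2

theorem exists_lintegral_rpow_le_of_le_one (hq : 1 < q) (hw : IsBekolleBonami q w)
    (h0 : weightedArea w ≠ 0) {p : ℝ} (hp0 : 0 < p) (hp : p ≤ 1) :
    ∃ C : ℝ≥0, ∀ f : ℂ → ℂ, DifferentiableOn ℂ f (ball 0 1) →
      ∫⁻ z, ‖f z - f 0‖ₑ ^ p ∂weightedArea w ≤
        C * ∫⁻ z, (‖deriv f z‖ₑ * ENNReal.ofReal (bdryDist z)) ^ p ∂weightedArea w := by
  obtain ⟨C, hC⟩ := hw.exists_le_spreadAverage hq h0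
  have := hw.isFiniteMeasure hq
  refine ⟨C * ((1 / (1 - (2⁻¹ : ℝ) ^ p)).toNNReal * 2 ^ p), fun f hf =>
    lintegral_enorm_sub_rpow_le_of_tendsto w hf
      one_sub_half_pow_mem_Icc tendsto_one_sub_half_pow fun N => ?_⟩
  set μ := weightedArea w
  set G : ℂ → ℝ≥0∞ := (ball (0 : ℂ) 1).indicator fun z => ‖deriv f z‖ₑ ^ p with hGdef
  have hG : Measurable G := measurable_indicator_deriv_rpow hf hp0
  have hGs : HasSubmeanRoot q G := hasSubmeanRoot_indicator_deriv_rpow hf hp0 (by linarith)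
  set S : ℕ → ℂ → ℝ≥0∞ := fun n ζ => if (2⁻¹ : ℝ) ^ (n + 1) ≤ 2 * bdryDist ζ then
      ENNReal.ofReal ((2⁻¹ : ℝ) ^ (n + 1)) ^ p else 0 with hS
  have hSm : ∀ n, Measurable (S n) := fun n => Measurable.ite
    (measurableSet_le measurable_const (continuous_bdryDist.measurable.const_mul 2))
    measurable_const measurable_const
  have hstep : ∀ n, ∀ z ∈ ball (0 : ℂ) 1,
      ‖f ((1 - (2⁻¹ : ℝ) ^ (n + 1) : ℝ) * z) - f ((1 - (2⁻¹ : ℝ) ^ n : ℝ) * z)‖ₑ ^ p ≤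
        C * spreadAverage μ (fun ζ => S n ζ * G ζ) z := by
    intro n z hz
    have ha := one_sub_half_pow_mem_Icc n
    have hb := one_sub_half_pow_mem_Icc (n + 1)
    -- The `n`-th radial piece is exactly as long as the distance of its outer end from 1, so length
    -- and truncation level agree.
    have hab : 1 - (2⁻¹ : ℝ) ^ (n + 1) - (1 - (2⁻¹ : ℝ) ^ n) = (2⁻¹ : ℝ) ^ (n + 1) := by
      rw [pow_succ]; ring
    have hpos : 0 < (2⁻¹ : ℝ) ^ (n + 1) := by positivity
    set κ := ENNReal.ofReal ((2⁻¹ : ℝ) ^ (n + 1)) with hκ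
    set M := C * spreadAverage μ
      ({ζ | (2⁻¹ : ℝ) ^ (n + 1) ≤ 2 * bdryDist ζ}.indicator G) z with hM
    have hbound : ∀ t ∈ Set.Icc (1 - (2⁻¹ : ℝ) ^ n) (1 - (2⁻¹ : ℝ) ^ (n + 1)),
        ‖deriv (fun s : ℝ => f (s * z)) t‖ₑ ≤ M ^ p⁻¹ := by
      intro t ht
      have ht' : t ∈ Set.Icc (0 : ℝ) 1 := ⟨ha.1.trans ht.1, ht.2.trans hb.2⟩
      rw [(hf.hasDerivAt_comp_real_mul hz ht').deriv, enorm_mul]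
      refine (mul_le_of_le_one_right' (enorm_le_one_of_mem_ball hz)).trans ?_
      rw [ENNReal.le_rpow_inv_iff hp0]
      have h1 := hC G hG hGs z hz t ht'
      rw [hGdef, Set.indicator_of_mem (real_mul_mem_ball hz ht'), ← hGdef] at h1
      refine h1.trans (mul_le_mul_right (spreadAverage_mono (fun ζ _ => ?_) z) _)
      refine Set.indicator_le_indicator_of_subset (fun ζ hζ => ?_) (fun _ => zero_le) ζ
      rw [Set.mem_ofPred_eq] at hζ ⊢
      rw [mem_ball_zero_iff] at hz
      nlinarith [ht.2, ht'.1]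
    have hint : ‖f ((1 - (2⁻¹ : ℝ) ^ (n + 1) : ℝ) * z) - f ((1 - (2⁻¹ : ℝ) ^ n : ℝ) * z)‖ₑ ≤
        M ^ p⁻¹ * κ := by
      refine (enorm_sub_le_lintegral_deriv_of_contDiffOn_Icc
        ((hf.contDiffOn_comp_real_mul hz).mono (Set.Icc_subset_Icc ha.1 hb.2))
        (by linarith)).trans ?_
      refine (setLIntegral_mono' measurableSet_Icc hbound).trans ?_
      rw [setLIntegral_const, Real.volume_Icc, hab]
    refine (ENNReal.rpow_le_rpow hint hp0.le).trans ?_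
    rw [ENNReal.mul_rpow_of_nonneg _ _ hp0.le, ← ENNReal.rpow_mul, inv_mul_cancel₀ hp0.ne',
      ENNReal.rpow_one, hM, mul_assoc, mul_comm (spreadAverage _ _ _),
      ← spreadAverage_const_mul (ENNReal.rpow_ne_top_of_nonneg hp0.le ENNReal.ofReal_ne_top)]
    refine mul_le_mul_right (spreadAverage_mono (fun ζ _ => ?_) z) _
    by_cases hζ : (2⁻¹ : ℝ) ^ (n + 1) ≤ 2 * bdryDist ζ
    · rw [Set.indicator_of_mem
        (show ζ ∈ {ζ | (2⁻¹ : ℝ) ^ (n + 1) ≤ 2 * bdryDist ζ} from hζ), hS]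
      simp only [if_pos hζ]
      exact le_rfl
    · rw [Set.indicator_of_notMem
        (show ζ ∉ {ζ | (2⁻¹ : ℝ) ^ (n + 1) ≤ 2 * bdryDist ζ} from hζ), mul_zero]
      exact zero_le
  have hsum : ∀ z ∈ ball (0 : ℂ) 1, ∀ n : ℕ, ‖f ((1 - (2⁻¹ : ℝ) ^ n : ℝ) * z) - f 0‖ₑ ^ p ≤
      C * spreadAverage μ (fun ζ => (∑ k ∈ Finset.range n, S k ζ) * G ζ) z := by
    intro z hz n
    induction n with
    -- The first radius is `1 - 2⁻¹ ^ 0 = 0`, so the left side is `‖f 0 - f 0‖ₑ ^ p = 0`.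
    | zero => simp [hp0]
    | succ n ih =>
      have hadd : spreadAverage μ (fun ζ => (∑ k ∈ Finset.range (n + 1), S k ζ) * G ζ) z =
          spreadAverage μ (fun ζ => S n ζ * G ζ) z +
            spreadAverage μ (fun ζ => (∑ k ∈ Finset.range n, S k ζ) * G ζ) z := by
        refine Eq.trans ?_ (spreadAverage_add (H := fun ζ => S n ζ * G ζ) ((hSm n).mul hG) _ z)
        congr 1
        funext ζ
        rw [Finset.sum_range_succ]
        ring
      rw [hadd, mul_add, ← sub_add_sub_cancel _ (f ((1 - (2⁻¹ : ℝ) ^ n : ℝ) * z))]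
      refine (ENNReal.rpow_le_rpow (enorm_add_le _ _) hp0.le).trans ?_
      exact (ENNReal.rpow_add_le_add_rpow _ _ hp0.le hp).trans (add_le_add (hstep n z hz) ih)
  have hδ : Measurable fun ζ => ENNReal.ofReal (2 * bdryDist ζ) ^ p :=
    (continuous_bdryDist.measurable.const_mul 2).ennreal_ofReal.pow_const p
  have hpt : ∀ z ∈ ball (0 : ℂ) 1, ‖f ((1 - (2⁻¹ : ℝ) ^ N : ℝ) * z) - f 0‖ₑ ^ p ≤
      C * (ENNReal.ofReal (1 / (1 - (2⁻¹ : ℝ) ^ p)) * spreadAverage μ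
        (fun ζ => ENNReal.ofReal (2 * bdryDist ζ) ^ p * G ζ) z) := by
    intro z hz
    refine (hsum z hz N).trans ?_
    rw [← spreadAverage_const_mul ENNReal.ofReal_ne_top]
    refine mul_le_mul_right (spreadAverage_mono (fun ζ hζ => ?_) z) _
    rw [← mul_assoc]
    exact mul_le_mul_left
      (sum_dyadic_rpow_indicator_le hp0 (by linarith [bdryDist_pos hζ]) N) _
  calc ∫⁻ z, ‖f ((1 - (2⁻¹ : ℝ) ^ N : ℝ) * z) - f 0‖ₑ ^ p ∂μ
      ≤ ∫⁻ z, C * (ENNReal.ofReal (1 / (1 - (2⁻¹ : ℝ) ^ p)) * spreadAverage μ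
          (fun ζ => ENNReal.ofReal (2 * bdryDist ζ) ^ p * G ζ) z) ∂μ := by
        refine lintegral_mono_ae ?_
        filter_upwards [ae_weightedArea_mem_ball w] with z hz using hpt z hz
    _ ≤ C * (ENNReal.ofReal (1 / (1 - (2⁻¹ : ℝ) ^ p)) *
          ∫⁻ ζ, ENNReal.ofReal (2 * bdryDist ζ) ^ p * G ζ ∂μ) := by
        rw [lintegral_const_mul' _ _ ENNReal.coe_ne_top,
          lintegral_const_mul' _ _ ENNReal.ofReal_ne_top]
        exact mul_le_mul_right (mul_le_mul_right (lintegral_spreadAverage_le (hδ.mul hG)) _) _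
    _ = _ := by
        rw [hGdef, lintegral_indicator_deriv_rpow_mul w f hp0, ENNReal.coe_mul, ENNReal.coe_mul,
          ENNReal.coe_rpow_of_nonneg _ hp0.le, ENNReal.ofReal]
        push_cast
        ring

end IsBekolleBonami

theorem mainTheorem2 (p q : ℝ) (hp : 0 < p) (hq : 1 < q) (w : ℂ → ℝ≥0)
    (hw : IsBekolleBonami q w) :
    ∃ K : ℝ≥0, ∀ f : ℂ → ℂ, DifferentiableOn ℂ f (ball 0 1) →
      eLpNorm (fun z => f z - f 0) (ENNReal.ofReal p) (weightedArea w) ≤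
        K * eLpNorm (fun z => deriv f z * (bdryDist z : ℂ)) (ENNReal.ofReal p)
          (weightedArea w) := by
  -- The weight `w = 0` satisfies the condition through `0 * ∞ = 0`, and positivity of `w` almost
  -- everywhere then fails; both norms vanish.
  by_cases h0 : weightedArea w = 0
  · exact ⟨0, fun f _ => by simp [h0]⟩
  obtain ⟨C, hC⟩ : ∃ C : ℝ≥0, ∀ f : ℂ → ℂ, DifferentiableOn ℂ f (ball 0 1) →
      ∫⁻ z, ‖f z - f 0‖ₑ ^ p ∂weightedArea w ≤
        C * ∫⁻ z, (‖deriv f z‖ₑ * ENNReal.ofReal (bdryDist z)) ^ p ∂weightedArea w := by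
    rcases le_or_gt p 1 with h | h
    · exact hw.exists_lintegral_rpow_le_of_le_one hq h0 hp h
    · exact hw.exists_lintegral_rpow_le_of_one_lt hq h0 h
  refine ⟨C ^ (1 / p), fun f hf => ?_⟩
  have hp' : ENNReal.ofReal p ≠ 0 := by simpa using hp
  rw [eLpNorm_eq_lintegral_rpow_enorm_toReal hp' ENNReal.ofReal_ne_top,
    eLpNorm_eq_lintegral_rpow_enorm_toReal hp' ENNReal.ofReal_ne_top, ENNReal.toReal_ofReal hp.le,
    ENNReal.coe_rpow_of_nonneg _ (by positivity), ← ENNReal.mul_rpow_of_nonneg _ _ (by positivity)]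
  refine ENNReal.rpow_le_rpow ((hC f hf).trans_eq ?_) (by positivity)
  congr 1
  refine lintegral_congr_ae ?_
  filter_upwards [ae_weightedArea_mem_ball w] with z hz
  rw [enorm_mul, ← ofReal_norm (bdryDist z : ℂ), Complex.norm_real,
    Real.norm_of_nonneg (bdryDist_pos hz).le]
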